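/- For $\omega\in\mathbb{R}$ let $\Delta$ be the bounded operator on $\ell^2(\mathbb{Z}^2)$ given by \begin{align*} \Delta f(m,n)={}& e^{-3i\omega m} f(m,n+1)+e^{3i\omega m} f(m,n-1) +e^{3i\omega n} f(m+1,n)+e^{-3i\omega n} f(m-1,n)\\ &+e^{-3i\omega(m+n)} f(m-1,n+1)+e^{3i\omega(m+n)} f(m+1,n-1). \end{align*} If $\omega\in\frac{\pi}{6}+\pi\mathbb{Z}$ or $\omega\in-\frac{\pi}{6}+\pi\mathbb{Z}$, then $\Delta$ is self-adjoint and its spectrum is purely absolutely continuous (for every $\psi\in\ell^2(\mathbb{Z}^2)$ the spectral measure of $\Delta$ at $\psi$ is absolutely continuous with respect to Lebesgue measure on $\mathbb{R}$), and \[ \operatorname{spec}\Delta=\big[-2\sqrt3,-\sqrt3\,\big]\cup\big[\sqrt3,2\sqrt3\,\big]. \] -/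

import Mathlib

open MeasureTheory
open scoped lp BoundedContinuousFunction

noncomputable section

namespace MagneticLattice

/-- The Hilbert space `ℓ²(ℤ²)` of complex-valued square-summable functions. -/
abbrev L2Z2 : Type := lp (fun _ : ℤ × ℤ => ℂ) 2

theorem memlp_phase_shift (a : ℤ × ℤ → ℝ) (v : ℤ × ℤ) (f : L2Z2) :
    Memℓp (fun x : ℤ × ℤ => Complex.exp (Complex.I * (a x : ℂ)) * f (x + v)) 2 := by
  have h2 : 0 < (2 : ENNReal).toReal := by norm_num
  have hf := (memℓp_gen_iff h2).1 (lp.memℓp f)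
  refine (memℓp_gen_iff h2).2 ?_
  have hs := (Equiv.addRight v).summable_iff.2 hf
  refine hs.congr fun x => ?_
  simp [mul_comm Complex.I, Complex.norm_exp_ofReal_mul_I]

/-- The magnetic translation `f ↦ (x ↦ e^{i a(x)} f(x + v))`, an isometry of `ℓ²(ℤ²)`. -/
def phaseShift (a : ℤ × ℤ → ℝ) (v : ℤ × ℤ) : L2Z2 →ₗᵢ[ℂ] L2Z2 where
  toFun f := ⟨fun x => Complex.exp (Complex.I * (a x : ℂ)) * f (x + v), memlp_phase_shift a v f⟩
  map_add' f g := by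
    ext x
    exact mul_add _ _ _
  map_smul' c f := by
    ext x
    simp [mul_left_comm]
  norm_map' f := by
    have h2 : 0 < (2 : ENNReal).toReal := by norm_num
    rw [lp.norm_eq_tsum_rpow h2, lp.norm_eq_tsum_rpow h2,
      ← (Equiv.addRight v).tsum_eq (fun x => ‖f x‖ ^ (2 : ENNReal).toReal)]
    congr 1
    refine tsum_congr fun x => ?_
    simp [mul_comm Complex.I, Complex.norm_exp_ofReal_mul_I]

/-- The magnetic tight-binding operator `Δ` of the triangular lattice, with magnetic
parameter `ω`, as a bounded operator on `ℓ²(ℤ²)`. -/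
def Delta (ω : ℝ) : L2Z2 →L[ℂ] L2Z2 :=
  (phaseShift (fun x => -3 * ω * x.1) (0, 1)).toContinuousLinearMap
    + (phaseShift (fun x => 3 * ω * x.1) (0, -1)).toContinuousLinearMap
    + (phaseShift (fun x => 3 * ω * x.2) (1, 0)).toContinuousLinearMap
    + (phaseShift (fun x => -3 * ω * x.2) (-1, 0)).toContinuousLinearMap
    + (phaseShift (fun x => -3 * ω * (x.1 + x.2)) (-1, 1)).toContinuousLinearMap
    + (phaseShift (fun x => 3 * ω * (x.1 + x.2)) (1, -1)).toContinuousLinearMap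

/-- The pointwise formula for `Δ`. -/
theorem Delta_apply (ω : ℝ) (f : L2Z2) (m n : ℤ) :
    Delta ω f (m, n) =
      Complex.exp (-3 * Complex.I * ω * m) * f (m, n + 1)
      + Complex.exp (3 * Complex.I * ω * m) * f (m, n - 1)
      + Complex.exp (3 * Complex.I * ω * n) * f (m + 1, n)
      + Complex.exp (-3 * Complex.I * ω * n) * f (m - 1, n)
      + Complex.exp (-3 * Complex.I * ω * (m + n)) * f (m - 1, n + 1)
      + Complex.exp (3 * Complex.I * ω * (m + n)) * f (m + 1, n - 1) := by
  simp only [Delta, phaseShift, _root_.add_apply, lp.coeFn_add, Pi.add_apply,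
    LinearIsometry.coe_toContinuousLinearMap, LinearIsometry.coe_mk, LinearMap.coe_mk,
    AddHom.coe_mk, Prod.mk_add_mk, add_zero, ← sub_eq_add_neg]
  push_cast
  ring_nf

/-- `μ` is the (scalar) spectral measure of the bounded self-adjoint operator `A` at the
vector `ψ`: the finite Borel measure on `ℝ` with `⟨ψ, g(A) ψ⟩ = ∫ g dμ` for every bounded
continuous `g`, where `g(A)` is given by the continuous functional calculus. -/
def IsSpectralMeasure {H : Type*} [NormedAddCommGroup H] [InnerProductSpace ℂ H]
    [CompleteSpace H] (A : H →L[ℂ] H) (ψ : H) (μ : Measure ℝ) : Prop :=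
  IsFiniteMeasure μ ∧
    ∀ g : ℝ →ᵇ ℝ, inner ℂ ψ ((cfc (fun t : ℝ => g t) A) ψ) = ((∫ t, g t ∂μ : ℝ) : ℂ)

/-- `A` is self-adjoint with purely absolutely continuous spectrum: the spectral measure of
every vector is absolutely continuous with respect to Lebesgue measure. -/
def HasPurelyACSpectrum {H : Type*} [NormedAddCommGroup H] [InnerProductSpace ℂ H]
    [CompleteSpace H] (A : H →L[ℂ] H) : Prop :=
  IsSelfAdjoint A ∧ ∀ ψ : H, ∃ μ : Measure ℝ, IsSpectralMeasure A ψ μ ∧ μ ≪ volume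

end MagneticLattice

end

/-!
Put `s = e^{3iω}`. The magnetic translations `U f(m, n) = s^{-m} f(m, n + 1)` and
`V f(m, n) = s^n f(m + 1, n)` satisfy `U V = s² V U`, and `Δ = (U + U*) + (V + V*) + (W + W*)` with
`W = s U V*`. When `s² = -1` the unitaries `U`, `V`, `W` anticommute pairwise, hence so do the three
summands, and `Δ²` is the sum of their squares. As `W² = U² V*²`, this gives `Δ² = 3 + N* N` with
`N = 1 + U² + V²`, where `U²` and `V²` commute.

The basis vector `ψ` at a lattice point is orthogonal to its images under all monomials in `U` and
`V`. So `⟨ψ, Δ^{2j} ψ⟩` is the constant Fourier coefficient of the `j`-th power of the dispersion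
relation `3 + |1 + e^{2πix} + e^{2πiy}|²`, and the odd moments vanish: the spectral measure at `ψ`
is the symmetrised law of the square root of the dispersion relation, whose values on the torus fill
`[3, 12]`.
-/

open scoped FourierTransform

noncomputable section

namespace MagneticLattice

section MomentProblem

theorem integrable_polynomial_eval {μ : Measure ℝ} [IsFiniteMeasure μ] {a b : ℝ}
    (hμ : ∀ᵐ t ∂μ, t ∈ Set.Icc a b) (p : Polynomial ℝ) : Integrable (fun t => p.eval t) μ := by
  rw [← Measure.restrict_eq_self_of_ae_mem hμ]
  exact p.continuous.continuousOn.integrableOn_Icc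

theorem integral_polynomial_eval {μ : Measure ℝ} [IsFiniteMeasure μ] {a b : ℝ}
    (hμ : ∀ᵐ t ∂μ, t ∈ Set.Icc a b) (p : Polynomial ℝ) :
    ∫ t, p.eval t ∂μ = p.sum fun k c => c * ∫ t, t ^ k ∂μ := by
  simp only [Polynomial.eval_eq_sum, Polynomial.sum]
  rw [integral_finsetSum]
  · simp only [integral_const_mul]
  · intro k _
    simpa using integrable_polynomial_eval hμ (Polynomial.monomial k (p.coeff k))

theorem tendsto_integral_polynomial_eval {μ : Measure ℝ} [IsFiniteMeasure μ] {a b : ℝ}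
    (hμ : ∀ᵐ t ∂μ, t ∈ Set.Icc a b) (g : ℝ →ᵇ ℝ) {p : ℕ → Polynomial ℝ}
    (hp : ∀ n, ∀ t ∈ Set.Icc a b, |(p n).eval t - g t| < 1 / ((n : ℝ) + 1)) :
    Filter.Tendsto (fun n => ∫ t, (p n).eval t ∂μ) Filter.atTop (nhds (∫ t, g t ∂μ)) := by
  rw [tendsto_iff_norm_sub_tendsto_zero]
  have hlim := tendsto_one_div_add_atTop_nhds_zero_nat (𝕜 := ℝ).mul_const (μ.real Set.univ)
  rw [zero_mul] at hlim
  refine squeeze_zero (fun _ => norm_nonneg _) (fun n => ?_) hlim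
  rw [← integral_sub (integrable_polynomial_eval hμ (p n)) (g.integrable μ)]
  exact norm_integral_le_of_norm_le_const (hμ.mono fun t ht => (hp n t ht).le)

theorem ext_of_forall_integral_pow_eq {μ ν : Measure ℝ} [IsFiniteMeasure μ] [IsFiniteMeasure ν]
    {a b : ℝ} (hμ : ∀ᵐ t ∂μ, t ∈ Set.Icc a b) (hν : ∀ᵐ t ∂ν, t ∈ Set.Icc a b)
    (h : ∀ k : ℕ, ∫ t, t ^ k ∂μ = ∫ t, t ^ k ∂ν) : μ = ν := by
  refine ext_of_forall_integral_eq_of_IsFiniteMeasure fun g => ?_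
  choose p hp using fun n : ℕ => exists_polynomial_near_of_continuousOn a b g
    g.continuous.continuousOn (1 / ((n : ℝ) + 1)) (by positivity)
  refine tendsto_nhds_unique (tendsto_integral_polynomial_eval hμ g hp) ?_
  convert tendsto_integral_polynomial_eval hν g hp using 2 with n
  simp only [integral_polynomial_eval hμ, integral_polynomial_eval hν, h]

end MomentProblem

section SpectralMeasure

variable {H : Type*} [NormedAddCommGroup H] [InnerProductSpace ℂ H] [CompleteSpace H]
  {A : H →L[ℂ] H}

/-- The positive functional `f ↦ ⟨ψ, f(A) ψ⟩` on the continuous functions on the spectrum of the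
self-adjoint operator `A`, which the Riesz–Markov–Kakutani theorem turns into a measure. -/
def spectralFunctional (hA : IsSelfAdjoint A) (ψ : H) :
    CompactlySupportedContinuousMap (spectrum ℝ A) ℝ →ₚ[ℝ] ℝ :=
  PositiveLinearMap.mk₀
    { toFun := fun f => (inner ℂ ψ (cfcHom hA f.toContinuousMap ψ)).re
      map_add' := fun f g => by
        have hfg : (f + g).toContinuousMap = f.toContinuousMap + g.toContinuousMap := rfl
        simp [hfg]
      map_smul' := fun c f => by
        have hcf : (c • f).toContinuousMap = c • f.toContinuousMap := rfl
        simp [hcf, inner_smul_right_eq_smul] }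
    fun f hf => by
      have hpos : 0 ≤ cfcHom hA f.toContinuousMap := (cfcHom_nonneg_iff hA).2 hf
      have hinner := ((ContinuousLinearMap.nonneg_iff_isPositive _).1 hpos).inner_nonneg_right ψ
      exact (Complex.le_def.1 hinner).1

/-- The spectral measure of the self-adjoint operator `A` at the vector `ψ`, as a measure on the
whole real line. -/
def spectralMeasure (hA : IsSelfAdjoint A) (ψ : H) : Measure ℝ :=
  (RealRMK.rieszMeasure (spectralFunctional hA ψ)).map Subtype.val

instance (hA : IsSelfAdjoint A) (ψ : H) : IsFiniteMeasure (spectralMeasure hA ψ) := by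
  unfold spectralMeasure
  infer_instance

theorem inner_cfc_eq_integral_spectralMeasure (hA : IsSelfAdjoint A) (ψ : H) {g : ℝ → ℝ}
    (hg : Continuous g) :
    inner ℂ ψ (cfc g A ψ) = ((∫ t, g t ∂spectralMeasure hA ψ : ℝ) : ℂ) := by
  let f : CompactlySupportedContinuousMap (spectrum ℝ A) ℝ :=
    CompactlySupportedContinuousMap.continuousMapEquiv
      ⟨fun x => g x, hg.comp continuous_subtype_val⟩
  have hsymm := (cfc_predicate g A : IsSelfAdjoint _).isSymmetric.coe_re_inner_self_apply ψ
  rw [spectralMeasure,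
    integral_map measurable_subtype_coe.aemeasurable hg.aestronglyMeasurable]
  calc inner ℂ ψ (cfc g A ψ) = ((inner ℂ ψ (cfc g A ψ)).re : ℂ) := hsymm.symm
    _ = ((spectralFunctional hA ψ f : ℝ) : ℂ) := by
      rw [cfc_apply g A hA hg.continuousOn]
      rfl
    _ = _ := congrArg _ (RealRMK.integral_rieszMeasure _ f).symm

theorem isSpectralMeasure_spectralMeasure (hA : IsSelfAdjoint A) (ψ : H) :
    IsSpectralMeasure A ψ (spectralMeasure hA ψ) :=
  ⟨inferInstance, fun g => inner_cfc_eq_integral_spectralMeasure hA ψ g.continuous⟩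

theorem IsSpectralMeasure.eq_spectralMeasure {ψ : H} {μ : Measure ℝ} (h : IsSpectralMeasure A ψ μ)
    (hA : IsSelfAdjoint A) : μ = spectralMeasure hA ψ := by
  have := h.1
  refine ext_of_forall_integral_eq_of_IsFiniteMeasure fun g => Complex.ofReal_injective ?_
  rw [← h.2 g, inner_cfc_eq_integral_spectralMeasure hA ψ g.continuous]

theorem inner_pow_eq_integral_spectralMeasure (hA : IsSelfAdjoint A) (ψ : H) (k : ℕ) :
    inner ℂ ψ ((A ^ k) ψ) = ((∫ t, t ^ k ∂spectralMeasure hA ψ : ℝ) : ℂ) := by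
  rw [← inner_cfc_eq_integral_spectralMeasure hA ψ (continuous_pow k), cfc_pow_id A k hA]

theorem spectralMeasure_compl_spectrum (hA : IsSelfAdjoint A) (ψ : H) :
    spectralMeasure hA ψ (spectrum ℝ A)ᶜ = 0 := by
  rw [spectralMeasure, Measure.map_apply measurable_subtype_coe
    (spectrum.isClosed A).isOpen_compl.measurableSet]
  simp

theorem support_spectralMeasure_subset (hA : IsSelfAdjoint A) (ψ : H) :
    (spectralMeasure hA ψ).support ⊆ spectrum ℝ A :=
  Measure.support_subset_of_isClosed (spectrum.isClosed A) (spectralMeasure_compl_spectrum hA ψ)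

theorem spectralMeasure_eq_of_forall_inner_pow (hA : IsSelfAdjoint A) {ψ : H} {μ : Measure ℝ}
    [IsFiniteMeasure μ] {a b : ℝ} (hspec : spectrum ℝ A ⊆ Set.Icc a b)
    (hμ : ∀ᵐ t ∂μ, t ∈ Set.Icc a b)
    (h : ∀ k : ℕ, inner ℂ ψ ((A ^ k) ψ) = ((∫ t, t ^ k ∂μ : ℝ) : ℂ)) :
    spectralMeasure hA ψ = μ := by
  have hconc : ∀ᵐ t ∂spectralMeasure hA ψ, t ∈ Set.Icc a b :=
    measure_mono_null (Set.compl_subset_compl.2 hspec) (spectralMeasure_compl_spectrum hA ψ)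
  refine ext_of_forall_integral_pow_eq hconc hμ fun k => Complex.ofReal_injective ?_
  rw [← h, inner_pow_eq_integral_spectralMeasure hA]

theorem spectralMeasure_zero (hA : IsSelfAdjoint A) : spectralMeasure hA 0 = 0 :=
  (IsSpectralMeasure.eq_spectralMeasure ⟨inferInstance, fun g => by simp⟩ hA).symm

theorem spectralMeasure_smul (hA : IsSelfAdjoint A) (c : ℂ) (ψ : H) :
    spectralMeasure hA (c • ψ) = ‖c‖₊ ^ 2 • spectralMeasure hA ψ := by
  refine (IsSpectralMeasure.eq_spectralMeasure ⟨inferInstance, fun g => ?_⟩ hA).symm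
  rw [map_smul, inner_smul_left, inner_smul_right,
    inner_cfc_eq_integral_spectralMeasure hA ψ g.continuous, integral_smul_nnreal_measure,
    ← mul_assoc, mul_comm _ c, Complex.mul_conj', NNReal.smul_def]
  push_cast
  simp

theorem spectralMeasure_add_add_spectralMeasure_sub (hA : IsSelfAdjoint A) (φ ψ : H) :
    spectralMeasure hA (φ + ψ) + spectralMeasure hA (φ - ψ) =
      (2 : NNReal) • (spectralMeasure hA φ + spectralMeasure hA ψ) := by
  refine ext_of_forall_integral_eq_of_IsFiniteMeasure fun g => Complex.ofReal_injective ?_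
  rw [integral_smul_nnreal_measure, integral_add_measure (g.integrable _) (g.integrable _),
    integral_add_measure (g.integrable _) (g.integrable _), NNReal.smul_def]
  push_cast
  simp only [smul_eq_mul, Complex.ofReal_mul, Complex.ofReal_add,
    ← inner_cfc_eq_integral_spectralMeasure hA _ g.continuous, map_add, map_sub,
    inner_add_left, inner_add_right, inner_sub_left, inner_sub_right]
  push_cast
  ring

theorem spectralMeasure_add_le (hA : IsSelfAdjoint A) (φ ψ : H) :
    spectralMeasure hA (φ + ψ) ≤ (2 : NNReal) • (spectralMeasure hA φ + spectralMeasure hA ψ) := by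
  rw [← spectralMeasure_add_add_spectralMeasure_sub]
  exact Measure.le_add_right le_rfl

theorem spectralMeasure_univ (hA : IsSelfAdjoint A) (ψ : H) :
    spectralMeasure hA ψ Set.univ = ENNReal.ofReal (‖ψ‖ ^ 2) := by
  have hmass : inner ℂ ψ ψ = (((spectralMeasure hA ψ).real Set.univ : ℝ) : ℂ) := by
    simpa using inner_pow_eq_integral_spectralMeasure hA ψ 0
  rw [← ofReal_measureReal]
  congr 1
  apply Complex.ofReal_injective
  rw [← hmass, inner_self_eq_norm_sq_to_K]
  push_cast
  rfl

/-- The subspace of vectors whose spectral measure is absolutely continuous with respect to `ν`. -/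
def acSubspace (hA : IsSelfAdjoint A) (ν : Measure ℝ) : Submodule ℂ H where
  carrier := {ψ | spectralMeasure hA ψ ≪ ν}
  zero_mem' := by
    rw [Set.mem_ofPred_eq, spectralMeasure_zero]
    exact Measure.AbsolutelyContinuous.zero ν
  add_mem' {φ ψ} hφ hψ :=
    (spectralMeasure_add_le hA φ ψ).absolutelyContinuous.trans
      ((Measure.AbsolutelyContinuous.add_left hφ hψ).smul_left _)
  smul_mem' c ψ hψ := by
    rw [Set.mem_ofPred_eq, spectralMeasure_smul]
    exact Measure.AbsolutelyContinuous.smul_left hψ _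

theorem isClosed_acSubspace (hA : IsSelfAdjoint A) (ν : Measure ℝ) :
    IsClosed (acSubspace hA ν : Set H) := by
  refine isClosed_of_closure_subset fun ψ hψ s hs => ?_
  obtain ⟨φ, hφ, hlim⟩ := mem_closure_iff_seq_limit.1 hψ
  have hle (n : ℕ) : spectralMeasure hA ψ s ≤ 2 * ENNReal.ofReal (‖ψ - φ n‖ ^ 2) := by
    have hadd := spectralMeasure_add_le hA (φ n) (ψ - φ n) s
    rw [add_sub_cancel] at hadd
    refine hadd.trans ?_
    rw [Measure.smul_apply, Measure.add_apply, hφ n hs, zero_add, ← spectralMeasure_univ hA]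
    exact mul_le_mul_right (measure_mono (Set.subset_univ s)) _
  have hnorm : Filter.Tendsto (fun n => ‖ψ - φ n‖ ^ 2) Filter.atTop (nhds 0) := by
    simpa using ((hlim.const_sub ψ).norm.pow 2)
  have hbound := ENNReal.Tendsto.const_mul (a := 2) (ENNReal.tendsto_ofReal hnorm) (by simp)
  simpa using ge_of_tendsto' hbound hle

theorem hasPurelyACSpectrum_of_topologicalClosure_span_eq_top (hA : IsSelfAdjoint A) {S : Set H}
    (hS : (Submodule.span ℂ S).topologicalClosure = ⊤)
    (hac : ∀ ψ ∈ S, spectralMeasure hA ψ ≪ volume) : HasPurelyACSpectrum A := by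
  have htop : acSubspace hA volume = ⊤ := top_le_iff.1 <| hS.symm.le.trans <|
    Submodule.topologicalClosure_minimal _ (Submodule.span_le.2 hac) (isClosed_acSubspace hA volume)
  exact ⟨hA, fun ψ => ⟨_, isSpectralMeasure_spectralMeasure hA ψ,
    (htop ▸ Submodule.mem_top : ψ ∈ acSubspace hA volume)⟩⟩

end SpectralMeasure

section QuasiMeasurePreserving

theorem quasiMeasurePreserving_of_ae_hasStrictFDerivAt {E : Type*} [NormedAddCommGroup E]
    [NormedSpace ℝ E] [FiniteDimensional ℝ E] [MeasurableSpace E] [BorelSpace E] (μ : Measure E)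
    [μ.IsAddHaarMeasure] {f : E → E} (hf : Measurable f)
    (hf' : ∀ᵐ x ∂μ, ∃ f' : E ≃L[ℝ] E, HasStrictFDerivAt f (f' : E →L[ℝ] E) x) :
    Measure.QuasiMeasurePreserving f μ μ := by
  have := FiniteDimensional.complete ℝ E
  refine ⟨hf, Measure.AbsolutelyContinuous.mk fun s hs h0 => ?_⟩
  rw [Measure.map_apply hf hs]
  let R := {x | ∃ f' : E ≃L[ℝ] E, HasStrictFDerivAt f (f' : E →L[ℝ] E) x}
  have hregular : μ (f ⁻¹' s ∩ R) = 0 := by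
    refine measure_null_of_locally_null _ fun x ⟨_, f', hx⟩ => ?_
    let e := hx.toOpenPartialHomeomorph f
    refine ⟨f ⁻¹' s ∩ R ∩ e.source, inter_mem_nhdsWithin _
      (e.open_source.mem_nhds hx.mem_toOpenPartialHomeomorph_source), ?_⟩
    have himage : e.symm '' (e '' (f ⁻¹' s ∩ R ∩ e.source)) = f ⁻¹' s ∩ R ∩ e.source :=
      e.symm_image_image_of_subset_source Set.inter_subset_right
    rw [← himage]
    refine addHaar_image_eq_zero_of_differentiableOn_of_addHaar_eq_zero μ ?_
      (measure_mono_null (Set.image_subset_iff.2 fun y hy => hy.1.1) h0)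
    rintro _ ⟨y, ⟨⟨-, g', hy⟩, hye⟩, rfl⟩
    refine (e.hasStrictFDerivAt_symm (f' := g') (e.map_source hye) ?_).differentiableAt
      |>.differentiableWithinAt
    rwa [e.left_inv hye]
  exact measure_mono_null (fun x hx => or_iff_not_imp_right.2 fun hxR => ⟨hx, not_not.1 hxR⟩)
    (measure_union_null hregular hf')

theorem quasiMeasurePreserving_of_ae_hasStrictDerivAt {f : ℝ → ℝ} (hf : Measurable f)
    (hf' : ∀ᵐ x, ∃ f' ≠ 0, HasStrictDerivAt f f' x) :
    Measure.QuasiMeasurePreserving f :=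
  quasiMeasurePreserving_of_ae_hasStrictFDerivAt volume hf
    (hf'.mono fun _ ⟨_, hne, hderiv⟩ => ⟨_, hderiv.hasStrictFDerivAt_equiv hne⟩)

end QuasiMeasurePreserving

section Dispersion

/-- The dispersion relation of `Δ²`: the value of `3 + N*N`, `N = 1 + X + Y`, at the point
`(X, Y) = (e^{2πi z.1}, e^{2πi z.2})` of the torus. -/
def dispersion (z : ℝ × ℝ) : ℝ := 3 + ‖1 + (𝐞 z.1 : ℂ) + 𝐞 z.2‖ ^ 2

theorem continuous_dispersion : Continuous dispersion := by
  unfold dispersion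
  fun_prop

theorem continuous_sqrt_dispersion : Continuous fun z => √(dispersion z) :=
  continuous_dispersion.sqrt

theorem continuous_neg_sqrt_dispersion : Continuous fun z => -√(dispersion z) :=
  continuous_sqrt_dispersion.neg

theorem three_le_dispersion (z : ℝ × ℝ) : 3 ≤ dispersion z :=
  le_add_of_nonneg_right (sq_nonneg _)

theorem dispersion_le_twelve (z : ℝ × ℝ) : dispersion z ≤ 12 := by
  have hnorm : ‖1 + (𝐞 z.1 : ℂ) + 𝐞 z.2‖ ≤ 3 := norm_add₃_le.trans (by
    simp only [norm_one, Circle.norm_coe]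
    norm_num)
  have := pow_le_pow_left₀ (norm_nonneg _) hnorm 2
  unfold dispersion
  linarith

theorem dispersion_eq_cos (x y : ℝ) :
    dispersion (x, y) = 6 + 2 * Real.cos (2 * Real.pi * x) + 2 * Real.cos (2 * Real.pi * y) +
      2 * Real.cos (2 * Real.pi * x - 2 * Real.pi * y) := by
  rw [dispersion, Complex.sq_norm, Complex.normSq_apply, Real.cos_sub]
  simp only [Real.fourierChar_apply, Complex.add_re, Complex.add_im, Complex.one_re,
    Complex.one_im, Complex.exp_ofReal_mul_I_re, Complex.exp_ofReal_mul_I_im]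
  linear_combination Real.sin_sq_add_cos_sq (2 * Real.pi * x) +
    Real.sin_sq_add_cos_sq (2 * Real.pi * y)

theorem exists_dispersion_eq {t : ℝ} (ht : t ∈ Set.Icc (3 : ℝ) 12) :
    ∃ z ∈ Set.Icc (0 : ℝ × ℝ) 1, dispersion z = t := by
  obtain ⟨h3, h12⟩ := ht
  have hsqrt : √(t - 3) ≤ 3 := Real.sqrt_le_iff.2 ⟨by norm_num, by linarith⟩
  obtain ⟨θ, hθ0, hθ1, hθ⟩ : ∃ θ : ℝ, 0 ≤ θ ∧ θ ≤ 1 ∧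
      Real.cos (2 * Real.pi * θ) = (√(t - 3) - 1) / 2 := by
    refine ⟨Real.arccos ((√(t - 3) - 1) / 2) / (2 * Real.pi),
      div_nonneg (Real.arccos_nonneg _) Real.two_pi_pos.le, ?_, ?_⟩
    · rw [div_le_one (by positivity)]
      linarith [Real.arccos_le_pi ((√(t - 3) - 1) / 2), Real.pi_pos]
    · rw [mul_div_cancel₀ _ (by positivity),
        Real.cos_arccos (by linarith [Real.sqrt_nonneg (t - 3)]) (by linarith)]
  refine ⟨(θ, 1 - θ), ⟨⟨hθ0, sub_nonneg.2 hθ1⟩, ⟨hθ1, sub_le_self 1 hθ0⟩⟩, ?_⟩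
  have hsqrt' : √(t - 3) ^ 2 = t - 3 := Real.sq_sqrt (sub_nonneg.2 h3)
  rw [dispersion_eq_cos, show 2 * Real.pi * (1 - θ) = 2 * Real.pi - 2 * Real.pi * θ by ring,
    Real.cos_two_pi_sub, show 2 * Real.pi * θ - (2 * Real.pi - 2 * Real.pi * θ) =
      2 * (2 * Real.pi * θ) - 2 * Real.pi by ring, Real.cos_sub_two_pi, Real.cos_two_mul, hθ]
  linear_combination hsqrt'

theorem hasStrictDerivAt_dispersion (x y : ℝ) :
    HasStrictDerivAt (fun y => dispersion (x, y))
      (8 * Real.pi * (Real.sin (Real.pi * (x - 2 * y)) * Real.cos (Real.pi * x))) y := by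
  simp only [dispersion_eq_cos]
  have hlin := (hasStrictDerivAt_id y).const_mul (2 * Real.pi)
  refine HasStrictDerivAt.congr_deriv (((hlin.cos.const_mul 2).const_add _).add
    ((hlin.const_sub (2 * Real.pi * x)).cos.const_mul 2)) ?_
  have hsin := Real.sin_sub_sin (2 * Real.pi * x - 2 * Real.pi * y) (2 * Real.pi * y)
  rw [show (2 * Real.pi * x - 2 * Real.pi * y - 2 * Real.pi * y) / 2 =
      Real.pi * (x - 2 * y) by ring,
    show (2 * Real.pi * x - 2 * Real.pi * y + 2 * Real.pi * y) / 2 = Real.pi * x by ring] at hsin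
  simp only [id]
  linear_combination 4 * Real.pi * hsin

theorem ae_cos_pi_mul_ne_zero : ∀ᵐ x : ℝ, Real.cos (Real.pi * x) ≠ 0 := by
  refine Set.Countable.ae_notMem (s := {x | Real.cos (Real.pi * x) = 0}) ?_ volume
  refine (Set.countable_range fun k : ℤ => (2 * k + 1 : ℝ) / 2).mono fun x hx => ?_
  obtain ⟨k, hk⟩ := Real.cos_eq_zero_iff.1 hx
  exact ⟨k, mul_left_cancel₀ Real.pi_ne_zero (by linarith)⟩

theorem ae_sin_pi_mul_sub_ne_zero (x : ℝ) : ∀ᵐ y : ℝ, Real.sin (Real.pi * (x - 2 * y)) ≠ 0 := by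
  refine Set.Countable.ae_notMem (s := {y | Real.sin (Real.pi * (x - 2 * y)) = 0}) ?_ volume
  refine (Set.countable_range fun k : ℤ => (x - k) / 2).mono fun y hy => ?_
  obtain ⟨k, hk⟩ := Real.sin_eq_zero_iff.1 hy
  rw [mul_comm, mul_right_inj' Real.pi_ne_zero] at hk
  exact ⟨k, by simp only [hk]; ring⟩

theorem quasiMeasurePreserving_sqrt_dispersion :
    Measure.QuasiMeasurePreserving (fun z => √(dispersion z)) := by
  refine QuasiMeasurePreserving.prod_of_right continuous_sqrt_dispersion.measurable ?_
  filter_upwards [ae_cos_pi_mul_ne_zero] with x hx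
  refine quasiMeasurePreserving_of_ae_hasStrictDerivAt
    (continuous_sqrt_dispersion.measurable.comp measurable_prodMk_left)
    ((ae_sin_pi_mul_sub_ne_zero x).mono fun y hy => ?_)
  have hpos : 0 < dispersion (x, y) := by linarith [three_le_dispersion (x, y)]
  exact ⟨_, by positivity, (hasStrictDerivAt_dispersion x y).sqrt hpos.ne'⟩

end Dispersion

section BandMeasure

/-- The normalized Haar measure of the torus `ℝ²/ℤ²`, which is represented by the unit square. -/
def squareMeasure : Measure (ℝ × ℝ) := volume.restrict (Set.Icc 0 1)

instance : IsFiniteMeasure squareMeasure :=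
  isFiniteMeasure_restrict.2 isCompact_Icc.measure_lt_top.ne

theorem integrable_squareMeasure {E : Type*} [NormedAddCommGroup E] {f : ℝ × ℝ → E}
    (hf : Continuous f) : Integrable f squareMeasure :=
  hf.continuousOn.integrableOn_compact isCompact_Icc

theorem Icc_subset_support_squareMeasure : Set.Icc 0 1 ⊆ squareMeasure.support := by
  have hclosure : closure (interior (Set.Icc (0 : ℝ × ℝ) 1)) = Set.Icc 0 1 := by
    rw [Set.Icc_prod_eq, interior_prod_eq, closure_prod_eq, interior_Icc, interior_Icc,
      closure_Ioo (by simp), closure_Ioo (by simp)]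
  rw [← hclosure]
  refine closure_minimal ?_ Measure.isClosed_support
  have hsupport := Measure.interior_inter_support (μ := volume) (s := Set.Icc (0 : ℝ × ℝ) 1)
  rwa [Measure.support_eq_univ, Set.inter_univ] at hsupport

/-- The distribution of `±√dispersion` with an independent fair sign at a uniformly distributed
point of the torus. It is the spectral measure of `Δ` at every lattice point. -/
def bandMeasure : Measure ℝ :=
  (2⁻¹ : NNReal) • (squareMeasure.map (fun z => √(dispersion z)) +
    squareMeasure.map (fun z => -√(dispersion z)))

instance : IsFiniteMeasure bandMeasure := by
  unfold bandMeasure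
  infer_instance

theorem bandMeasure_absolutelyContinuous : bandMeasure ≪ volume :=
  have hpos := quasiMeasurePreserving_sqrt_dispersion.mono_left
    (Measure.restrict_le_self (s := Set.Icc 0 1)).absolutelyContinuous
  have hneg := (Measure.measurePreserving_neg volume).quasiMeasurePreserving.comp hpos
  (hpos.absolutelyContinuous.add_left hneg.absolutelyContinuous).smul_left _

theorem integral_bandMeasure {f : ℝ → ℝ} (hf : Continuous f) :
    ∫ t, f t ∂bandMeasure =
      2⁻¹ * ∫ z, (f √(dispersion z) + f (-√(dispersion z))) ∂squareMeasure := by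
  have hcpos := continuous_sqrt_dispersion.aemeasurable (μ := squareMeasure)
  have hcneg := continuous_neg_sqrt_dispersion.aemeasurable (μ := squareMeasure)
  have hpos := integrable_squareMeasure (hf.comp continuous_sqrt_dispersion)
  have hneg := integrable_squareMeasure (hf.comp continuous_neg_sqrt_dispersion)
  rw [bandMeasure, integral_smul_nnreal_measure, integral_add_measure,
    integral_map hcpos hf.aestronglyMeasurable,
    integral_map hcneg hf.aestronglyMeasurable, NNReal.smul_def]
  · exact congrArg _ (integral_add hpos hneg).symm
  · exact (integrable_map_measure hf.aestronglyMeasurable hcpos).2 hpos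
  · exact (integrable_map_measure hf.aestronglyMeasurable hcneg).2 hneg

theorem integral_pow_even_bandMeasure (k : ℕ) :
    ∫ t, t ^ (2 * k) ∂bandMeasure = ∫ z, dispersion z ^ k ∂squareMeasure := by
  rw [integral_bandMeasure (continuous_pow _), ← integral_const_mul]
  refine integral_congr_ae (.of_forall fun z => ?_)
  have hnonneg : 0 ≤ dispersion z := by linarith [three_le_dispersion z]
  simp only [pow_mul, neg_sq, Real.sq_sqrt hnonneg]
  ring

theorem integral_pow_odd_bandMeasure {k : ℕ} (hk : Odd k) : ∫ t, t ^ k ∂bandMeasure = 0 := by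
  simp [integral_bandMeasure (continuous_pow _), hk.neg_pow]

theorem ae_bandMeasure_sq_mem_Icc : ∀ᵐ t ∂bandMeasure, t ^ 2 ∈ Set.Icc (3 : ℝ) 12 := by
  have hsq (z : ℝ × ℝ) : √(dispersion z) ^ 2 ∈ Set.Icc (3 : ℝ) 12 := by
    rw [Real.sq_sqrt (by linarith [three_le_dispersion z])]
    exact ⟨three_le_dispersion z, dispersion_le_twelve z⟩
  have hmeas : MeasurableSet {t : ℝ | t ^ 2 ∈ Set.Icc (3 : ℝ) 12} :=
    measurable_id.pow_const 2 measurableSet_Icc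
  refine Measure.ae_smul_measure (ae_add_measure_iff.2 ⟨?_, ?_⟩) _
  · exact (ae_map_iff continuous_sqrt_dispersion.aemeasurable hmeas).2 (.of_forall hsq)
  · refine (ae_map_iff continuous_neg_sqrt_dispersion.aemeasurable hmeas).2
      (.of_forall fun z => ?_)
    simpa only [neg_sq] using hsq z

theorem image_support_subset_support_map {X Y : Type*} [TopologicalSpace X] [MeasurableSpace X]
    [TopologicalSpace Y] [MeasurableSpace Y] {μ : Measure X} {f : X → Y} (hf : Continuous f)
    (hm : AEMeasurable f μ) : f '' μ.support ⊆ (μ.map f).support := by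
  rintro _ ⟨x, hx, rfl⟩
  rw [Measure.mem_support_iff_forall] at hx ⊢
  exact fun U hU => (hx _ (hf.continuousAt hU)).trans_le (Measure.le_map_apply hm U)

theorem subset_support_bandMeasure :
    {t : ℝ | t ^ 2 ∈ Set.Icc (3 : ℝ) 12} ⊆ bandMeasure.support := by
  intro t ht
  obtain ⟨z, hz, hzt⟩ := exists_dispersion_eq ht
  have hsub : (squareMeasure.map (fun z => √(dispersion z)) +
      squareMeasure.map (fun z => -√(dispersion z))).support ⊆ bandMeasure.support :=
    (Measure.absolutelyContinuous_smul (c := (2⁻¹ : NNReal)) (by simp)).support_mono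
  have hmem := Icc_subset_support_squareMeasure hz
  have hcpos := continuous_sqrt_dispersion.aemeasurable (μ := squareMeasure)
  have hcneg := continuous_neg_sqrt_dispersion.aemeasurable (μ := squareMeasure)
  refine hsub ?_
  rw [Measure.support_add]
  have habs : √(dispersion z) = |t| := by rw [hzt, Real.sqrt_sq_eq_abs]
  rcases abs_choice t with h | h
  · exact .inl (image_support_subset_support_map continuous_sqrt_dispersion hcpos
      ⟨z, hmem, habs.trans h⟩)
  · exact .inr (image_support_subset_support_map continuous_neg_sqrt_dispersion hcneg
      ⟨z, hmem, neg_eq_iff_eq_neg.2 (habs.trans h)⟩)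

end BandMeasure

section TriangularHamiltonian

theorem add_add_sq_of_anticommute {R : Type*} [Ring R] {a b c : R} (hab : a * b = -(b * a))
    (hac : a * c = -(c * a)) (hbc : b * c = -(c * b)) :
    (a + b + c) ^ 2 = a ^ 2 + b ^ 2 + c ^ 2 := by
  simp only [sq, add_mul, mul_add, hab, hac, hbc]
  abel

theorem commute_sq_of_anticommute {R : Type*} [Ring R] {a b : R} (h : a * b = -(b * a)) :
    Commute (a ^ 2) b := by
  rw [commute_iff_eq, sq, mul_assoc, h, mul_neg, ← mul_assoc, h, neg_mul, neg_neg, mul_assoc]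

variable {𝕜 R : Type*} [CommRing 𝕜] [StarRing 𝕜] [Ring R] [StarRing R] [Algebra 𝕜 R]
  [StarModule 𝕜 R]

theorem add_star_sq (U : unitary R) :
    ((U : R) + star (U : R)) ^ 2 = 2 + (U : R) ^ 2 + star ((U : R) ^ 2) := by
  have hmul := Unitary.mul_star_self_of_mem U.2
  have hmul' := Unitary.star_mul_self_of_mem U.2
  rw [star_pow, sq, sq, sq, add_mul, mul_add, mul_add, hmul, hmul', ← one_add_one_eq_two (R := R)]
  abel

theorem mul_star_eq_neg_of_anticommute {x : R} {V : unitary R} (h : x * V = -(V * x)) :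
    x * star (V : R) = -(star (V : R) * x) := by
  have hmul := Unitary.mul_star_self_of_mem V.2
  have hmul' := Unitary.star_mul_self_of_mem V.2
  calc x * star (V : R) = star (V : R) * (V * x) * star (V : R) := by
        rw [← mul_assoc, hmul', one_mul]
    _ = -(star (V : R) * x) := by
        rw [← neg_eq_iff_eq_neg.2 h, mul_neg, neg_mul, mul_assoc, mul_assoc, hmul, mul_one]

theorem mul_add_star_of_anticommute {x : R} {V : unitary R} (h : x * V = -(V * x)) :
    x * (V + star (V : R)) = -((V + star (V : R)) * x) := by
  rw [mul_add, add_mul, h, mul_star_eq_neg_of_anticommute h, neg_add]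

theorem add_star_mul_add_star_of_anticommute {U V : unitary R} (h : (U : R) * V = -(V * U)) :
    ((U : R) + star (U : R)) * (V + star (V : R)) =
      -((V + star (V : R)) * (U + star (U : R))) :=
  have hV : (V + star (V : R)) * U = -(U * (V + star (V : R))) :=
    (neg_eq_iff_eq_neg.2 (mul_add_star_of_anticommute h)).symm
  (neg_eq_iff_eq_neg.2 (mul_add_star_of_anticommute hV)).symm

/-- The third hopping direction `s U V⁻¹` of the triangular lattice spanned by the magnetic
translations `U` and `V`. -/
def diagonalHopping (U V : unitary R) (s : unitary 𝕜) : unitary R := s • (U * V⁻¹)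

/-- The nearest neighbour hopping operator of the triangular lattice built from the magnetic
translations `U`, `V` and the phase `s`. -/
def triangularHamiltonian (U V : unitary R) (s : unitary 𝕜) : R :=
  U + star (U : R) + (V + star (V : R)) +
    (diagonalHopping U V s + star (diagonalHopping U V s : R))

theorem isSelfAdjoint_triangularHamiltonian (U V : unitary R) (s : unitary 𝕜) :
    IsSelfAdjoint (triangularHamiltonian U V s) :=
  ((IsSelfAdjoint.add_star_self _).add (.add_star_self _)).add (.add_star_self _)

theorem coe_diagonalHopping (U V : unitary R) (s : unitary 𝕜) :
    (diagonalHopping U V s : R) = (s : 𝕜) • ((U : R) * star (V : R)) := rfl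

variable {U V : unitary R} {s : unitary 𝕜}

theorem left_mul_diagonalHopping (h : (U : R) * V = -(V * U)) :
    (U : R) * diagonalHopping U V s = -(diagonalHopping U V s * U) := by
  rw [coe_diagonalHopping, mul_smul_comm, smul_mul_assoc, ← smul_neg, mul_assoc, ← mul_neg,
    mul_star_eq_neg_of_anticommute h]

theorem right_mul_diagonalHopping (h : (U : R) * V = -(V * U)) :
    (V : R) * diagonalHopping U V s = -(diagonalHopping U V s * V) := by
  rw [coe_diagonalHopping, mul_smul_comm, smul_mul_assoc, ← smul_neg, ← mul_assoc,
    ← neg_eq_iff_eq_neg.2 h, neg_mul, mul_assoc, mul_assoc,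
    Unitary.mul_star_self_of_mem V.2, Unitary.star_mul_self_of_mem V.2]

theorem diagonalHopping_sq (h : (U : R) * V = -(V * U)) (hs : (s : 𝕜) ^ 2 = -1) :
    (diagonalHopping U V s : R) ^ 2 = (U : R) ^ 2 * star ((V : R) ^ 2) := by
  calc (diagonalHopping U V s : R) ^ 2
      = -((U : R) * (star (V : R) * U) * star (V : R)) := by
        rw [coe_diagonalHopping, smul_pow, hs, neg_one_smul, sq]
        simp only [mul_assoc]
    _ = (U : R) ^ 2 * star ((V : R) ^ 2) := by
        rw [← neg_mul, ← mul_neg, ← mul_star_eq_neg_of_anticommute h, star_pow, sq, sq]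
        simp only [mul_assoc]

theorem triangularHamiltonian_sq (h : (U : R) * V = -(V * U)) (hs : (s : 𝕜) ^ 2 = -1) :
    triangularHamiltonian U V s ^ 2 =
      3 + star (1 + (U : R) ^ 2 + (V : R) ^ 2) * (1 + (U : R) ^ 2 + (V : R) ^ 2) := by
  have hcomm : Commute ((U : R) ^ 2) (star ((V : R) ^ 2)) := by
    rw [star_pow]
    exact (commute_sq_of_anticommute (mul_star_eq_neg_of_anticommute h)).pow_right 2
  have hcomm' : star ((U : R) ^ 2) * (V : R) ^ 2 = (V : R) ^ 2 * star ((U : R) ^ 2) := by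
    simpa only [star_mul, star_star] using (congrArg star hcomm.eq).symm
  have hU : star ((U : R) ^ 2) * (U : R) ^ 2 = 1 := Unitary.star_mul_self_of_mem (U ^ 2).2
  have hV : star ((V : R) ^ 2) * (V : R) ^ 2 = 1 := Unitary.star_mul_self_of_mem (V ^ 2).2
  rw [triangularHamiltonian, add_add_sq_of_anticommute
    (add_star_mul_add_star_of_anticommute h)
    (add_star_mul_add_star_of_anticommute (left_mul_diagonalHopping h))
    (add_star_mul_add_star_of_anticommute (right_mul_diagonalHopping h)),
    add_star_sq, add_star_sq, add_star_sq, diagonalHopping_sq h hs]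
  simp only [star_add, star_mul, star_star, star_one, add_mul, mul_add, one_mul, mul_one, hU, hV,
    hcomm.eq, hcomm', ← two_add_one_eq_three (R := R), ← one_add_one_eq_two (R := R)]
  abel

end TriangularHamiltonian

section Laurent

variable {G 𝕜 R : Type*} [Group G] [CommRing 𝕜] [Ring R] [Algebra 𝕜 R]

/-- The homomorphism `ℤ² → G` sending the standard basis to a pair of commuting elements. -/
def zpowProdHom {X Y : G} (h : Commute X Y) : Multiplicative (ℤ × ℤ) →* G where
  toFun p := X ^ p.toAdd.1 * Y ^ p.toAdd.2
  map_one' := by simp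
  map_mul' p q := by
    simp only [toAdd_mul, Prod.fst_add, Prod.snd_add, zpow_add]
    exact ((h.zpow_zpow _ _).symm.mul_mul_mul_comm _ _).symm

/-- The evaluation of Laurent polynomials in two variables at a pair of commuting elements `X`, `Y`
of a group represented in an algebra. -/
def laurentEval (𝕜) [CommRing 𝕜] [Algebra 𝕜 R] (φ : G →* R) {X Y : G} (h : Commute X Y) :
    AddMonoidAlgebra 𝕜 (ℤ × ℤ) →ₐ[𝕜] R :=
  AddMonoidAlgebra.lift 𝕜 R (ℤ × ℤ) (φ.comp (zpowProdHom h))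

theorem laurentEval_single (φ : G →* R) {X Y : G} (h : Commute X Y) (p : ℤ × ℤ) (c : 𝕜) :
    laurentEval 𝕜 φ h (AddMonoidAlgebra.single p c) = c • φ (X ^ p.1 * Y ^ p.2) :=
  AddMonoidAlgebra.lift_single ..

/-- The Laurent polynomial `3 + (1 + X⁻¹ + Y⁻¹)(1 + X + Y)`, whose evaluations include both `Δ²`
and its dispersion relation. -/
def bandSymbol : AddMonoidAlgebra ℂ (ℤ × ℤ) :=
  3 + (1 + .single (-1, 0) 1 + .single (0, -1) 1) * (1 + .single (1, 0) 1 + .single (0, 1) 1)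

theorem laurentEval_bandSymbol [Algebra ℂ R] (φ : G →* R) {X Y : G} (h : Commute X Y) :
    laurentEval ℂ φ h bandSymbol = 3 + (1 + φ X⁻¹ + φ Y⁻¹) * (1 + φ X + φ Y) := by
  simp only [bandSymbol, map_add, map_mul, map_one, map_ofNat, laurentEval_single, one_smul]
  simp

theorem laurentEval_bandSymbol_unitary [StarRing R] [Algebra ℂ R] {X Y : unitary R}
    (h : Commute X Y) : laurentEval ℂ (unitary R).subtype h bandSymbol =
      3 + star (1 + (X : R) + (Y : R)) * (1 + (X : R) + (Y : R)) := by
  simp [laurentEval_bandSymbol, ← Unitary.star_eq_inv]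

/-- The evaluation of Laurent polynomials at the point `(e^{2πi z.1}, e^{2πi z.2})` of the torus. -/
def torusEval (z : ℝ × ℝ) : AddMonoidAlgebra ℂ (ℤ × ℤ) →ₐ[ℂ] ℂ :=
  laurentEval ℂ Circle.coeHom (Commute.all (𝐞 z.1) (𝐞 z.2))

theorem torusEval_single (z : ℝ × ℝ) (p : ℤ × ℤ) (c : ℂ) :
    torusEval z (AddMonoidAlgebra.single p c) =
      c * (((𝐞 z.1 ^ p.1 : Circle) : ℂ) * ((𝐞 z.2 ^ p.2 : Circle) : ℂ)) :=
  laurentEval_single ..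

theorem torusEval_bandSymbol (z : ℝ × ℝ) : torusEval z bandSymbol = dispersion z := by
  have hconj : (starRingEnd ℂ) (1 + (𝐞 z.1 : ℂ) + 𝐞 z.2) =
      1 + ((𝐞 z.1)⁻¹ : Circle) + ((𝐞 z.2)⁻¹ : Circle) := by
    simp only [map_add, map_one, Circle.coe_inv_eq_conj]
  rw [dispersion, Complex.ofReal_add, Complex.ofReal_pow, ← Complex.conj_mul', hconj]
  exact laurentEval_bandSymbol ..

theorem continuous_torusEval (r : AddMonoidAlgebra ℂ (ℤ × ℤ)) :
    Continuous fun z => torusEval z r := by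
  induction r using AddMonoidAlgebra.induction_linear with
  | zero => simp [continuous_const]
  | add f g hf hg =>
    simp only [map_add]
    exact hf.add hg
  | single p c =>
    simp only [torusEval_single]
    have hchar : Continuous fun z : ℝ × ℝ => (𝐞 z.1 ^ p.1, 𝐞 z.2 ^ p.2) := by fun_prop
    exact ((continuous_subtype_val.comp hchar.fst).mul
      (continuous_subtype_val.comp hchar.snd)).const_mul c

theorem setIntegral_Icc_fourierChar_zpow (n : ℤ) :
    ∫ x in Set.Icc (0 : ℝ) 1, ((𝐞 x ^ n : Circle) : ℂ) = if n = 0 then 1 else 0 := by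
  split_ifs with hn
  · simp [hn]
  · have hexp (x : ℝ) : ((𝐞 x ^ n : Circle) : ℂ) =
        Complex.exp (n * (2 * Real.pi * Complex.I) * x) := by
      rw [Circle.coe_zpow, Real.fourierChar_apply, ← Complex.exp_int_mul]
      push_cast
      ring_nf
    rw [integral_Icc_eq_integral_Ioc, ← intervalIntegral.integral_of_le zero_le_one]
    simp only [hexp]
    rw [integral_exp_mul_complex (mul_ne_zero (Int.cast_ne_zero.2 hn) Complex.two_pi_I_ne_zero)]
    simp [Complex.exp_int_mul_two_pi_mul_I]

theorem integral_torusEval (r : AddMonoidAlgebra ℂ (ℤ × ℤ)) :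
    ∫ z, torusEval z r ∂squareMeasure = r.coeff 0 := by
  induction r using AddMonoidAlgebra.induction_linear with
  | zero => simp
  | add f g hf hg =>
    simp only [map_add]
    rw [integral_add (integrable_squareMeasure (continuous_torusEval f))
      (integrable_squareMeasure (continuous_torusEval g)), hf, hg]
    simp
  | single p c =>
    simp only [torusEval_single]
    rw [integral_const_mul, squareMeasure, Set.Icc_prod_eq, Measure.volume_eq_prod,
      ← Measure.prod_restrict, integral_prod_mul (fun x : ℝ => ((𝐞 x ^ p.1 : Circle) : ℂ))
      (fun y : ℝ => ((𝐞 y ^ p.2 : Circle) : ℂ))]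
    simp only [Prod.fst_zero, Prod.fst_one, Prod.snd_zero, Prod.snd_one,
      setIntegral_Icc_fourierChar_zpow, AddMonoidAlgebra.coeff_single, Finsupp.single_apply,
      Prod.ext_iff]
    split_ifs <;> simp_all

theorem integral_dispersion_pow (k : ℕ) :
    ((∫ z, dispersion z ^ k ∂squareMeasure : ℝ) : ℂ) = (bandSymbol ^ k).coeff 0 := by
  simp only [← integral_torusEval, map_pow, torusEval_bandSymbol, ← integral_complex_ofReal,
    Complex.ofReal_pow]

end Laurent

section Wandering

variable {H : Type*} [NormedAddCommGroup H] [InnerProductSpace ℂ H] [CompleteSpace H]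

/-- A unit vector orthogonal to all its translates under the nontrivial monomials in `U` and `V`. -/
structure IsWanderingVector (U V : unitary (H →L[ℂ] H)) (ψ : H) : Prop where
  norm_eq_one : ‖ψ‖ = 1
  inner_eq_zero {p : ℤ × ℤ} (hp : p ≠ 0) :
    inner ℂ ψ (((U ^ p.1 * V ^ p.2 : unitary (H →L[ℂ] H)) : H →L[ℂ] H) ψ) = 0

variable {U V : unitary (H →L[ℂ] H)} {s : unitary ℂ} {ψ : H}

theorem IsWanderingVector.inner_zpow_mul_zpow (hψ : IsWanderingVector U V ψ) (p : ℤ × ℤ) :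
    inner ℂ ψ (((U ^ p.1 * V ^ p.2 : unitary (H →L[ℂ] H)) : H →L[ℂ] H) ψ) =
      if p = 0 then 1 else 0 := by
  split_ifs with hp
  · simp [hp, inner_self_eq_norm_sq_to_K, hψ.norm_eq_one]
  · exact hψ.inner_eq_zero hp

theorem IsWanderingVector.inner_laurentEval (hψ : IsWanderingVector U V ψ) (h : Commute U V)
    (r : AddMonoidAlgebra ℂ (ℤ × ℤ)) :
    inner ℂ ψ (laurentEval ℂ (unitary (H →L[ℂ] H)).subtype h r ψ) = r.coeff 0 := by
  induction r using AddMonoidAlgebra.induction_linear with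
  | zero => simp
  | add f g hf hg =>
    rw [map_add, _root_.add_apply, inner_add_right, hf, hg]
    simp
  | single p c =>
    rw [laurentEval_single, _root_.smul_apply, inner_smul_right, Submonoid.subtype_apply,
      hψ.inner_zpow_mul_zpow]
    simp [Finsupp.single_apply]

theorem IsWanderingVector.sq_sq (hψ : IsWanderingVector U V ψ) :
    IsWanderingVector (U ^ 2) (V ^ 2) ψ where
  norm_eq_one := hψ.norm_eq_one
  inner_eq_zero {p} hp := by
    have hp2 : ((2 * p.1, 2 * p.2) : ℤ × ℤ) ≠ 0 := by simpa [Prod.ext_iff] using hp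
    simpa only [zpow_mul, zpow_ofNat] using hψ.inner_eq_zero hp2

theorem commute_sq_left_of_anticommute (h : (U : H →L[ℂ] H) * V = -(V * U)) :
    Commute (U ^ 2) V :=
  Subtype.ext (commute_sq_of_anticommute h).eq

theorem commute_sq_sq_of_anticommute (h : (U : H →L[ℂ] H) * V = -(V * U)) :
    Commute (U ^ 2) (V ^ 2) :=
  (commute_sq_left_of_anticommute h).pow_right 2

theorem zpow_mul_zpow_mul_sq_zpow_mul_sq_zpow {G : Type*} [Group G] {U V : G}
    (h : Commute (U ^ 2) V) (p q : ℤ × ℤ) :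
    U ^ p.1 * V ^ p.2 * ((U ^ 2) ^ q.1 * (V ^ 2) ^ q.2) =
      U ^ (p.1 + 2 * q.1) * V ^ (p.2 + 2 * q.2) := by
  rw [zpow_add, zpow_add, zpow_mul, zpow_mul, zpow_ofNat, zpow_ofNat]
  exact (h.zpow_zpow _ _).symm.mul_mul_mul_comm _ _

theorem IsWanderingVector.inner_zpow_mul_zpow_mul_laurentEval (hψ : IsWanderingVector U V ψ)
    (h : (U : H →L[ℂ] H) * V = -(V * U)) {p : ℤ × ℤ} (hp : Odd p.1 ∨ Odd p.2)
    (r : AddMonoidAlgebra ℂ (ℤ × ℤ)) :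
    inner ℂ ψ ((((U ^ p.1 * V ^ p.2 : unitary (H →L[ℂ] H)) : H →L[ℂ] H) *
      laurentEval ℂ (unitary (H →L[ℂ] H)).subtype (commute_sq_sq_of_anticommute h) r) ψ) = 0 := by
  induction r using AddMonoidAlgebra.induction_linear with
  | zero => simp
  | add f g hf hg => rw [map_add, mul_add, _root_.add_apply, inner_add_right, hf, hg, add_zero]
  | single q c =>
    have hpq : ((p.1 + 2 * q.1, p.2 + 2 * q.2) : ℤ × ℤ) ≠ 0 := by
      simp only [ne_eq, Prod.mk_eq_zero]
      grind
    rw [laurentEval_single, mul_smul_comm, _root_.smul_apply, inner_smul_right,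
      Submonoid.subtype_apply, ← Submonoid.coe_mul,
      zpow_mul_zpow_mul_sq_zpow_mul_sq_zpow (commute_sq_left_of_anticommute h),
      hψ.inner_eq_zero hpq, mul_zero]

theorem triangularHamiltonian_eq_sum_zpow_mul_zpow (h : (U : H →L[ℂ] H) * V = -(V * U)) :
    triangularHamiltonian U V s =
      ↑(U ^ (1 : ℤ) * V ^ (0 : ℤ)) + ↑(U ^ (-1 : ℤ) * V ^ (0 : ℤ)) +
      (↑(U ^ (0 : ℤ) * V ^ (1 : ℤ)) + ↑(U ^ (0 : ℤ) * V ^ (-1 : ℤ))) +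
      ((s : ℂ) • ↑(U ^ (1 : ℤ) * V ^ (-1 : ℤ)) -
        star (s : ℂ) • ↑(U ^ (-1 : ℤ) * V ^ (1 : ℤ))) := by
  have hVU : (V : H →L[ℂ] H) * star (U : H →L[ℂ] H) = -(star (U : H →L[ℂ] H) * V) :=
    mul_star_eq_neg_of_anticommute (neg_eq_iff_eq_neg.2 h).symm
  simp only [triangularHamiltonian, coe_diagonalHopping, star_smul, star_mul, star_star, hVU,
    zpow_zero, zpow_one, zpow_neg, mul_one, one_mul, Submonoid.coe_mul, ← Unitary.star_eq_inv,
    Unitary.coe_star, smul_neg, sub_eq_add_neg]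

theorem IsWanderingVector.inner_triangularHamiltonian_mul_laurentEval
    (hψ : IsWanderingVector U V ψ) (h : (U : H →L[ℂ] H) * V = -(V * U))
    (r : AddMonoidAlgebra ℂ (ℤ × ℤ)) :
    inner ℂ ψ ((triangularHamiltonian U V s *
      laurentEval ℂ (unitary (H →L[ℂ] H)).subtype (commute_sq_sq_of_anticommute h) r) ψ) = 0 := by
  have hmonomial (a b : ℤ) (hab : Odd a ∨ Odd b) :=
    hψ.inner_zpow_mul_zpow_mul_laurentEval h (p := (a, b)) hab r
  simp only [triangularHamiltonian_eq_sum_zpow_mul_zpow h, add_mul, sub_mul, smul_mul_assoc,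
    _root_.add_apply, _root_.sub_apply, _root_.smul_apply, inner_add_right, inner_sub_right,
    inner_smul_right]
  rw [hmonomial 1 0 (.inl odd_one), hmonomial (-1) 0 (.inl odd_neg_one),
    hmonomial 0 1 (.inr odd_one), hmonomial 0 (-1) (.inr odd_neg_one),
    hmonomial 1 (-1) (.inl odd_one), hmonomial (-1) 1 (.inr odd_one)]
  simp

end Wandering

section HamiltonianSpectrum

variable {H : Type*} [NormedAddCommGroup H] [InnerProductSpace ℂ H] [CompleteSpace H]
  {U V : unitary (H →L[ℂ] H)} {s : unitary ℂ} {ψ : H}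

theorem triangularHamiltonian_sq_eq_laurentEval (h : (U : H →L[ℂ] H) * V = -(V * U))
    (hs : (s : ℂ) ^ 2 = -1) :
    triangularHamiltonian U V s ^ 2 =
      laurentEval ℂ (unitary (H →L[ℂ] H)).subtype (commute_sq_sq_of_anticommute h) bandSymbol := by
  rw [triangularHamiltonian_sq h hs, laurentEval_bandSymbol_unitary]
  rfl

theorem norm_coe_unitary_le_one (W : unitary (H →L[ℂ] H)) : ‖(W : H →L[ℂ] H)‖ ≤ 1 := by
  simpa using (CStarRing.norm_coe_unitary_mul W 1).trans_le ContinuousLinearMap.norm_id_le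

theorem norm_one_add_coe_unitary_add_coe_unitary_le (X Y : unitary (H →L[ℂ] H)) :
    ‖1 + (X : H →L[ℂ] H) + Y‖ ≤ 3 :=
  calc ‖1 + (X : H →L[ℂ] H) + Y‖
      ≤ ‖(1 : H →L[ℂ] H)‖ + ‖(X : H →L[ℂ] H)‖ + ‖(Y : H →L[ℂ] H)‖ := norm_add₃_le
    _ ≤ 1 + 1 + 1 := by
        gcongr
        exacts [ContinuousLinearMap.norm_id_le, norm_coe_unitary_le_one X,
          norm_coe_unitary_le_one Y]
    _ = 3 := by norm_num

theorem spectrum_star_mul_self_subset_Icc (N : H →L[ℂ] H) :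
    spectrum ℝ (star N * N) ⊆ Set.Icc 0 (‖N‖ ^ 2) := by
  intro t ht
  refine ⟨spectrum_star_mul_self_nonneg _ ht, (le_abs_self t).trans ?_⟩
  calc |t| ≤ ‖star N * N‖ * ‖(1 : H →L[ℂ] H)‖ := spectrum.norm_le_norm_mul_of_mem ht
    _ ≤ ‖star N * N‖ * 1 := by gcongr; exact ContinuousLinearMap.norm_id_le
    _ = ‖N‖ ^ 2 := by rw [mul_one, CStarRing.norm_star_mul_self, sq]

theorem sq_mem_Icc_of_mem_spectrum_triangularHamiltonian (h : (U : H →L[ℂ] H) * V = -(V * U))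
    (hs : (s : ℂ) ^ 2 = -1) {t : ℝ} (ht : t ∈ spectrum ℝ (triangularHamiltonian U V s)) :
    t ^ 2 ∈ Set.Icc 3 12 := by
  have hsq : t ^ 2 ∈ spectrum ℝ (triangularHamiltonian U V s ^ 2) :=
    spectrum.pow_image_subset _ 2 ⟨t, ht, rfl⟩
  have hnorm := norm_one_add_coe_unitary_add_coe_unitary_le (U ^ 2) (V ^ 2)
  rw [triangularHamiltonian_sq h hs] at hsq
  simp only [SubmonoidClass.coe_pow] at hnorm
  generalize 1 + (U : H →L[ℂ] H) ^ 2 + (V : H →L[ℂ] H) ^ 2 = N at hsq hnorm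
  have hmem : t ^ 2 - 3 ∈ spectrum ℝ (star N * N) := by
    rwa [← spectrum.add_mem_add_iff (s := 3), sub_add_cancel, map_ofNat]
  obtain ⟨hnonneg, hle⟩ := spectrum_star_mul_self_subset_Icc N hmem
  have hnorm_sq : ‖N‖ ^ 2 ≤ 3 ^ 2 := pow_le_pow_left₀ (norm_nonneg N) hnorm 2
  exact ⟨by linarith, by linarith⟩

theorem sq_mem_Icc_subset_Icc : {t : ℝ | t ^ 2 ∈ Set.Icc 3 12} ⊆ Set.Icc (-4) 4 :=
  fun _ ht => abs_le_of_sq_le_sq' (ht.2.trans (by norm_num)) (by norm_num)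

theorem IsWanderingVector.inner_triangularHamiltonian_pow (hψ : IsWanderingVector U V ψ)
    (h : (U : H →L[ℂ] H) * V = -(V * U)) (hs : (s : ℂ) ^ 2 = -1) (k : ℕ) :
    inner ℂ ψ ((triangularHamiltonian U V s ^ k) ψ) = ((∫ t, t ^ k ∂bandMeasure : ℝ) : ℂ) := by
  obtain ⟨j, rfl | rfl⟩ := k.even_or_odd'
  · rw [pow_mul, triangularHamiltonian_sq_eq_laurentEval h hs, ← map_pow,
      hψ.sq_sq.inner_laurentEval, integral_pow_even_bandMeasure, integral_dispersion_pow]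
  · rw [pow_succ', pow_mul, triangularHamiltonian_sq_eq_laurentEval h hs, ← map_pow,
      hψ.inner_triangularHamiltonian_mul_laurentEval h, integral_pow_odd_bandMeasure ⟨j, rfl⟩,
      Complex.ofReal_zero]

theorem IsWanderingVector.spectralMeasure_triangularHamiltonian (hψ : IsWanderingVector U V ψ)
    (h : (U : H →L[ℂ] H) * V = -(V * U)) (hs : (s : ℂ) ^ 2 = -1) :
    spectralMeasure (isSelfAdjoint_triangularHamiltonian U V s) ψ = bandMeasure :=
  spectralMeasure_eq_of_forall_inner_pow (isSelfAdjoint_triangularHamiltonian U V s)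
    (fun _ ht => sq_mem_Icc_subset_Icc <|
      sq_mem_Icc_of_mem_spectrum_triangularHamiltonian h hs ht)
    (ae_bandMeasure_sq_mem_Icc.mono fun _ ht => sq_mem_Icc_subset_Icc ht)
    (hψ.inner_triangularHamiltonian_pow h hs)

theorem IsWanderingVector.spectrum_triangularHamiltonian (hψ : IsWanderingVector U V ψ)
    (h : (U : H →L[ℂ] H) * V = -(V * U)) (hs : (s : ℂ) ^ 2 = -1) :
    spectrum ℝ (triangularHamiltonian U V s) = {t | t ^ 2 ∈ Set.Icc 3 12} := by
  refine Set.Subset.antisymm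
    (fun t ht => sq_mem_Icc_of_mem_spectrum_triangularHamiltonian h hs ht)
    (subset_support_bandMeasure.trans ?_)
  rw [← hψ.spectralMeasure_triangularHamiltonian h hs]
  exact support_spectralMeasure_subset _ ψ

theorem hasPurelyACSpectrum_triangularHamiltonian (h : (U : H →L[ℂ] H) * V = -(V * U))
    (hs : (s : ℂ) ^ 2 = -1)
    (hdense : (Submodule.span ℂ {ψ | IsWanderingVector U V ψ}).topologicalClosure = ⊤) :
    HasPurelyACSpectrum (triangularHamiltonian U V s) := by
  refine hasPurelyACSpectrum_of_topologicalClosure_span_eq_top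
    (isSelfAdjoint_triangularHamiltonian U V s) hdense fun ψ hψ => ?_
  rw [IsWanderingVector.spectralMeasure_triangularHamiltonian hψ h hs]
  exact bandMeasure_absolutelyContinuous

end HamiltonianSpectrum

section Lattice

theorem phaseShift_mul_phaseShift (a b : ℤ × ℤ → ℝ) (v w : ℤ × ℤ) :
    (phaseShift a v).toContinuousLinearMap * (phaseShift b w).toContinuousLinearMap =
      (phaseShift (fun x => a x + b (x + v)) (v + w)).toContinuousLinearMap := by
  ext f x
  change Complex.exp (Complex.I * a x) * (Complex.exp (Complex.I * b (x + v)) * f (x + v + w)) =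
    Complex.exp (Complex.I * ↑(a x + b (x + v))) * f (x + (v + w))
  rw [Complex.ofReal_add, mul_add, Complex.exp_add, mul_assoc, add_assoc]

theorem phaseShift_zero_zero : (phaseShift (fun _ => 0) 0).toContinuousLinearMap = 1 := by
  ext f x
  change Complex.exp (Complex.I * ((0 : ℝ) : ℂ)) * f (x + 0) = f x
  simp

theorem phaseShift_const_add (θ : ℝ) (a : ℤ × ℤ → ℝ) (v : ℤ × ℤ) :
    (phaseShift (fun x => θ + a x) v).toContinuousLinearMap =
      Complex.exp (Complex.I * θ) • (phaseShift a v).toContinuousLinearMap := by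
  ext f x
  change Complex.exp (Complex.I * ↑(θ + a x)) * f (x + v) =
    Complex.exp (Complex.I * θ) * (Complex.exp (Complex.I * a x) * f (x + v))
  rw [Complex.ofReal_add, mul_add, Complex.exp_add, mul_assoc]

theorem phaseShift_mul_phaseShift_neg (a : ℤ × ℤ → ℝ) (v : ℤ × ℤ) :
    (phaseShift a v).toContinuousLinearMap *
      (phaseShift (fun x => -a (x - v)) (-v)).toContinuousLinearMap = 1 := by
  simp only [phaseShift_mul_phaseShift, add_sub_cancel_right, add_neg_cancel, phaseShift_zero_zero]

theorem star_phaseShift_mul_phaseShift (a : ℤ × ℤ → ℝ) (v : ℤ × ℤ) :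
    star (phaseShift a v).toContinuousLinearMap * (phaseShift a v).toContinuousLinearMap = 1 :=
  (phaseShift a v).adjoint_comp_self

theorem star_phaseShift (a : ℤ × ℤ → ℝ) (v : ℤ × ℤ) :
    star (phaseShift a v).toContinuousLinearMap =
      (phaseShift (fun x => -a (x - v)) (-v)).toContinuousLinearMap :=
  left_inv_eq_right_inv (star_phaseShift_mul_phaseShift a v) (phaseShift_mul_phaseShift_neg a v)

/-- The magnetic translation `phaseShift a v` as a unitary element of the algebra of bounded
operators. -/
def phaseUnitary (a : ℤ × ℤ → ℝ) (v : ℤ × ℤ) : unitary (L2Z2 →L[ℂ] L2Z2) :=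
  ⟨(phaseShift a v).toContinuousLinearMap, star_phaseShift_mul_phaseShift a v, by
    rw [star_phaseShift, phaseShift_mul_phaseShift_neg]⟩

theorem phaseUnitary_zero_zero : phaseUnitary (fun _ => 0) 0 = 1 :=
  Subtype.ext phaseShift_zero_zero

theorem phaseUnitary_mul (a b : ℤ × ℤ → ℝ) (v w : ℤ × ℤ) :
    phaseUnitary a v * phaseUnitary b w = phaseUnitary (fun x => a x + b (x + v)) (v + w) :=
  Subtype.ext (phaseShift_mul_phaseShift a b v w)

theorem phaseUnitary_inv (a : ℤ × ℤ → ℝ) (v : ℤ × ℤ) :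
    (phaseUnitary a v)⁻¹ = phaseUnitary (fun x => -a (x - v)) (-v) :=
  Subtype.ext (star_phaseShift a v)

theorem exists_phaseUnitary_zpow (a : ℤ × ℤ → ℝ) (v : ℤ × ℤ) (k : ℤ) :
    ∃ b, phaseUnitary a v ^ k = phaseUnitary b (k • v) := by
  induction k with
  | zero => exact ⟨fun _ => 0, by rw [zpow_zero, zero_smul, phaseUnitary_zero_zero]⟩
  | succ k ih =>
    obtain ⟨b, hb⟩ := ih
    exact ⟨_, by rw [zpow_add_one, hb, phaseUnitary_mul, add_smul, one_smul]⟩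
  | pred k ih =>
    obtain ⟨b, hb⟩ := ih
    exact ⟨_, by
      rw [zpow_sub_one, hb, phaseUnitary_inv, phaseUnitary_mul, sub_smul, one_smul,
        sub_eq_add_neg]⟩

/-- The translation in direction `(0, 1)` occurring in `Delta`. -/
def verticalTranslation (ω : ℝ) : unitary (L2Z2 →L[ℂ] L2Z2) :=
  phaseUnitary (fun x => -3 * ω * x.1) (0, 1)

/-- The translation in direction `(1, 0)` occurring in `Delta`. -/
def horizontalTranslation (ω : ℝ) : unitary (L2Z2 →L[ℂ] L2Z2) :=
  phaseUnitary (fun x => 3 * ω * x.2) (1, 0)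

/-- The phase `e^{3iω}` turning the product of the two lattice translations into the diagonal
hopping term of `Delta`. -/
def fluxPhase (ω : ℝ) : unitary ℂ :=
  ⟨Complex.exp (Complex.I * ↑(3 * ω)), by
    rw [Unitary.mem_iff_star_mul_self, Complex.star_def, Complex.conj_mul', mul_comm,
      Complex.norm_exp_ofReal_mul_I]
    simp⟩

theorem coe_fluxPhase (ω : ℝ) : (fluxPhase ω : ℂ) = Complex.exp (Complex.I * ↑(3 * ω)) := rfl

theorem verticalTranslation_mul_horizontalTranslation (ω : ℝ) :
    (verticalTranslation ω : L2Z2 →L[ℂ] L2Z2) * horizontalTranslation ω =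
      (fluxPhase ω : ℂ) ^ 2 •
        ((horizontalTranslation ω : L2Z2 →L[ℂ] L2Z2) * verticalTranslation ω) := by
  have hphase : (fluxPhase ω : ℂ) ^ 2 = Complex.exp (Complex.I * ↑(6 * ω)) := by
    rw [coe_fluxPhase, ← Complex.exp_nat_mul]
    push_cast
    ring_nf
  rw [hphase, verticalTranslation, horizontalTranslation, phaseUnitary, phaseUnitary,
    phaseShift_mul_phaseShift, phaseShift_mul_phaseShift, ← phaseShift_const_add]
  congr 2
  ext x
  push_cast [Prod.fst_add, Prod.snd_add]
  ring

theorem diagonalHopping_translations (ω : ℝ) :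
    diagonalHopping (verticalTranslation ω) (horizontalTranslation ω) (fluxPhase ω) =
      phaseUnitary (fun x => -3 * ω * (x.1 + x.2)) (-1, 1) := by
  refine Subtype.ext ?_
  rw [coe_diagonalHopping, coe_fluxPhase, verticalTranslation, horizontalTranslation, phaseUnitary,
    phaseUnitary, phaseUnitary, star_phaseShift, phaseShift_mul_phaseShift, ← phaseShift_const_add]
  congr 2
  ext x
  push_cast [Prod.snd_add, Prod.snd_sub]
  ring

theorem Delta_eq_triangularHamiltonian (ω : ℝ) :
    Delta ω =
      triangularHamiltonian (verticalTranslation ω) (horizontalTranslation ω) (fluxPhase ω) := by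
  have hvert : star (verticalTranslation ω : L2Z2 →L[ℂ] L2Z2) =
      (phaseShift (fun x => 3 * ω * x.1) (0, -1)).toContinuousLinearMap := by
    rw [verticalTranslation, phaseUnitary, star_phaseShift]
    simp
  have hhor : star (horizontalTranslation ω : L2Z2 →L[ℂ] L2Z2) =
      (phaseShift (fun x => -3 * ω * x.2) (-1, 0)).toContinuousLinearMap := by
    rw [horizontalTranslation, phaseUnitary, star_phaseShift]
    simp
  have hdiag : star (phaseUnitary (fun x => -3 * ω * (x.1 + x.2)) (-1, 1) : L2Z2 →L[ℂ] L2Z2) =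
      (phaseShift (fun x => 3 * ω * (x.1 + x.2)) (1, -1)).toContinuousLinearMap := by
    rw [phaseUnitary, star_phaseShift]
    simp
  rw [triangularHamiltonian, diagonalHopping_translations, hvert, hhor, hdiag, Delta]
  simp only [add_assoc]
  rfl

/-- The standard basis of `ℓ²(ℤ²)`. -/
def pointBasis : HilbertBasis (ℤ × ℤ) ℂ L2Z2 := .ofRepr (.refl ℂ L2Z2)

theorem inner_pointBasis (x : ℤ × ℤ) (f : L2Z2) : inner ℂ (pointBasis x) f = f x :=
  (pointBasis.repr_apply_apply f x).symm

theorem pointBasis_apply_of_ne {x y : ℤ × ℤ} (h : y ≠ x) : pointBasis x y = 0 :=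
  (inner_pointBasis y _).symm.trans (pointBasis.orthonormal.inner_eq_zero h)

theorem inner_pointBasis_phaseUnitary (a : ℤ × ℤ → ℝ) {v : ℤ × ℤ} (hv : v ≠ 0) (x : ℤ × ℤ) :
    inner ℂ (pointBasis x) ((phaseUnitary a v : L2Z2 →L[ℂ] L2Z2) (pointBasis x)) = 0 := by
  rw [inner_pointBasis]
  exact mul_eq_zero_of_right _ (pointBasis_apply_of_ne (by simpa using hv))

theorem isWanderingVector_pointBasis (ω : ℝ) (x : ℤ × ℤ) :
    IsWanderingVector (verticalTranslation ω) (horizontalTranslation ω) (pointBasis x) where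
  norm_eq_one := pointBasis.orthonormal.norm_eq_one x
  inner_eq_zero {p} hp := by
    obtain ⟨a, ha⟩ := exists_phaseUnitary_zpow (fun x => -3 * ω * x.1) (0, 1) p.1
    obtain ⟨b, hb⟩ := exists_phaseUnitary_zpow (fun x => 3 * ω * x.2) (1, 0) p.2
    have hne : p.1 • ((0, 1) : ℤ × ℤ) + p.2 • ((1, 0) : ℤ × ℤ) ≠ 0 := by
      simpa [Prod.ext_iff, and_comm] using hp
    rw [verticalTranslation, horizontalTranslation, ha, hb, phaseUnitary_mul,
      inner_pointBasis_phaseUnitary _ hne]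

theorem topologicalClosure_span_isWanderingVector (ω : ℝ) :
    (Submodule.span ℂ {ψ | IsWanderingVector (verticalTranslation ω) (horizontalTranslation ω)
      ψ}).topologicalClosure = ⊤ := by
  have hsub := Set.range_subset_iff.2 (isWanderingVector_pointBasis ω)
  exact top_le_iff.1 <| pointBasis.dense_span.symm.le.trans <|
    Submodule.topologicalClosure_mono (Submodule.span_mono hsub)

theorem fluxPhase_sq_of_cos_eq_zero {ω : ℝ} (hω : Real.cos (3 * ω) = 0) :
    (fluxPhase ω : ℂ) ^ 2 = -1 := by
  have hsin : Real.sin (3 * ω) ^ 2 = 1 := by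
    rw [Real.sin_sq, hω, zero_pow two_ne_zero, sub_zero]
  rw [coe_fluxPhase, mul_comm, Complex.exp_mul_I, ← Complex.ofReal_cos, ← Complex.ofReal_sin, hω,
    Complex.ofReal_zero, zero_add, mul_pow, Complex.I_sq, ← Complex.ofReal_pow, hsin,
    Complex.ofReal_one, one_mul]

theorem verticalTranslation_mul_horizontalTranslation_eq_neg {ω : ℝ} (hω : Real.cos (3 * ω) = 0) :
    (verticalTranslation ω : L2Z2 →L[ℂ] L2Z2) * horizontalTranslation ω =
      -((horizontalTranslation ω : L2Z2 →L[ℂ] L2Z2) * verticalTranslation ω) := by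
  rw [verticalTranslation_mul_horizontalTranslation, fluxPhase_sq_of_cos_eq_zero hω, neg_one_smul]

end Lattice

theorem cos_three_mul_eq_zero {ω : ℝ}
    (hω : ∃ k : ℤ, ω = Real.pi / 6 + k * Real.pi ∨ ω = -(Real.pi / 6) + k * Real.pi) :
    Real.cos (3 * ω) = 0 := by
  obtain ⟨k, rfl | rfl⟩ := hω <;> rw [Real.cos_eq_zero_iff]
  · exact ⟨3 * k, by push_cast; ring⟩
  · exact ⟨3 * k - 1, by push_cast; ring⟩

theorem sq_mem_Icc_iff {a b t : ℝ} (ha : 0 ≤ a) (hb : 0 ≤ b) :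
    t ^ 2 ∈ Set.Icc (a ^ 2) (b ^ 2) ↔ t ∈ Set.Icc (-b) (-a) ∪ Set.Icc a b := by
  simp only [Set.mem_Icc, Set.mem_union, sq_le_sq, abs_of_nonneg ha, abs_of_nonneg hb]
  grind

theorem setOf_sq_mem_Icc_three_twelve : {t : ℝ | t ^ 2 ∈ Set.Icc 3 12} =
    Set.Icc (-(2 * √3)) (-√3) ∪ Set.Icc (√3) (2 * √3) := by
  have hsq : √3 ^ 2 = (3 : ℝ) := Real.sq_sqrt (by norm_num)
  have hsq' : (2 * √3) ^ 2 = (12 : ℝ) := by rw [mul_pow, hsq]; norm_num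
  ext t
  rw [← sq_mem_Icc_iff (by positivity) (by positivity), hsq, hsq', Set.mem_ofPred_eq]

end MagneticLattice

end

open MagneticLattice in
theorem mainTheorem6_general (ω : ℝ) (hω : Real.cos (3 * ω) = 0) :
    MagneticLattice.HasPurelyACSpectrum (MagneticLattice.Delta ω) ∧
      spectrum ℂ (MagneticLattice.Delta ω) =
        Complex.ofReal '' (Set.Icc (-(2 * Real.sqrt 3)) (-Real.sqrt 3) ∪
          Set.Icc (Real.sqrt 3) (2 * Real.sqrt 3)) := by
  have hs := fluxPhase_sq_of_cos_eq_zero hω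
  have hanti := verticalTranslation_mul_horizontalTranslation_eq_neg hω
  have hspec := (isWanderingVector_pointBasis ω 0).spectrum_triangularHamiltonian hanti hs
  have hsa := isSelfAdjoint_triangularHamiltonian (verticalTranslation ω)
    (horizontalTranslation ω) (fluxPhase ω)
  rw [Delta_eq_triangularHamiltonian]
  refine ⟨hasPurelyACSpectrum_triangularHamiltonian hanti hs
    (topologicalClosure_span_isWanderingVector ω), ?_⟩
  rw [← setOf_sq_mem_Icc_three_twelve, ← hspec]
  exact hsa.spectrumRestricts.algebraMap_image.symm

theorem mainTheorem6 (ω : ℝ)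
    (hω : ∃ k : ℤ, ω = Real.pi / 6 + k * Real.pi ∨ ω = -(Real.pi / 6) + k * Real.pi) :
    MagneticLattice.HasPurelyACSpectrum (MagneticLattice.Delta ω) ∧
      spectrum ℂ (MagneticLattice.Delta ω) =
        Complex.ofReal '' (Set.Icc (-(2 * Real.sqrt 3)) (-Real.sqrt 3) ∪
          Set.Icc (Real.sqrt 3) (2 * Real.sqrt 3)) :=
  mainTheorem6_general ω (MagneticLattice.cos_three_mul_eq_zero hω)
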